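/- For integers $1\le m\le U$ let $M(U,m)=\sum_{0=s_0<s_1<\dots<s_m<s_{m+1}=U+1}\ \prod_{j=0}^{m}C_{s_{j+1}-s_j-1}$, where $C_n$ is the $n$-th Catalan number, and let $S$ be the random $m$-element subset of $\{1,\dots,U\}$ with $$\Pr[S=\{s_1,\dots,s_m\}]=\frac1{M(U,m)}\prod_{j=0}^{m}C_{s_{j+1}-s_j-1}\qquad(0=s_0<s_1<\dots<s_m<s_{m+1}=U+1).$$ For a real number $1\le k\le m^2$ (for instance $k=\log^4B$, where $B\ge 2$ and $\log^4 B$ lies in this range) put $L=\lfloor m^2/k\rfloor$, and let $\Delta$ be uniform on $\{1,\dots,L\}$ and independent of $S$. The intervals are $[\Delta+jL,\Delta+(j+1)L)$ for $j\in\mathbb Z$; an interval is non-empty if it contains a point of $S$. Claim: for all reals $0<a\le b$ there is a constant $C>0$, depending only on $a$ and $b$, such that the following holds for all such $m,U,k$ with $a m^2\le U\le b m^2$ (that is, $U=\Theta(m^2)$). If $S'$ is a random set with $S'\subseteq S$ almost surely, arbitrarily jointly distributed with $(S,\Delta)$, and $\mathbb E|S'|=(1-\epsilon)m$, then the number of non-empty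 intervals that contain no point of $S'$ is integrable and its expectation over the joint distribution of $S,\Delta,S'$ is at most $C\,(\sqrt{\epsilon k}+\log m)$. -/

import Mathlib

open MeasureTheory

universe u

open Classical in
/-- The sequences `0 = s_0 < s_1 < ... < s_m < s_{m+1} = U + 1`. -/
noncomputable def pointSeqs (U m : ℕ) : Finset (Fin (m + 2) → Fin (U + 2)) :=
  Finset.univ.filter fun s => StrictMono s ∧ s 0 = 0 ∧ s (Fin.last (m + 1)) = Fin.last (U + 1)

/-- The weight `∏_{j=0}^m C_{s_{j+1} - s_j - 1}` of a sequence, with `C_n` the Catalan numbers. -/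
def gapWeight {U m : ℕ} (s : Fin (m + 2) → Fin (U + 2)) : ℕ :=
  ∏ j : Fin (m + 1), catalan ((s j.succ : ℕ) - (s j.castSucc : ℕ) - 1)

/-- The normalizing constant `M(U, m)`. -/
noncomputable def totalWeight (U m : ℕ) : ℕ := ∑ s ∈ pointSeqs U m, gapWeight s

/-- The set `{s_1, ..., s_m}` of the interior terms of a sequence. -/
def pointSet {U m : ℕ} (s : Fin (m + 2) → Fin (U + 2)) : Finset ℕ :=
  Finset.univ.image fun i : Fin m => (s i.castSucc.succ : ℕ)

/-- A random variable with values in a countable type, all of whose subsets are measurable. -/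
def DiscreteRV {Ω α : Type*} [MeasurableSpace Ω] (X : Ω → α) : Prop :=
  ∀ a, MeasurableSet {ω | X ω = a}

/-- `S` is a random `m`-element subset of `{1, ..., U}` with
`Pr[S = {s_1, ..., s_m}] = (1 / M(U, m)) * ∏_{j=0}^m C_{s_{j+1} - s_j - 1}`. -/
def HasCatalanLaw {Ω : Type*} [MeasurableSpace Ω] (P : Measure Ω) (U m : ℕ)
    (S : Ω → Finset ℕ) : Prop :=
  ∀ s ∈ pointSeqs U m,
    P {ω | S ω = pointSet s} = ENNReal.ofReal ((gapWeight s : ℝ) / (totalWeight U m : ℝ))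

/-- `Δ` is uniform on `{1, ..., L}`. -/
def IsUniformOffset {Ω : Type*} [MeasurableSpace Ω] (P : Measure Ω) (L : ℕ) (Δ : Ω → ℕ) : Prop :=
  ∀ δ ∈ Finset.Icc 1 L, P {ω | Δ ω = δ} = ENNReal.ofReal (1 / (L : ℝ))

/-- Independence of discrete random variables. -/
def DiscreteIndep {Ω α β : Type*} [MeasurableSpace Ω] (P : Measure Ω) (X : Ω → α) (Y : Ω → β) :
    Prop :=
  ∀ a b, P {ω | X ω = a ∧ Y ω = b} = P {ω | X ω = a} * P {ω | Y ω = b}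

/-- The finite set `t` has a point in the `j`-th interval `[δ + j L, δ + (j + 1) L)`. -/
def MeetsInterval (L δ : ℕ) (t : Finset ℕ) (j : ℤ) : Prop :=
  ∃ x ∈ t, (δ : ℤ) + j * L ≤ (x : ℤ) ∧ (x : ℤ) < (δ : ℤ) + (j + 1) * L

/-- The number of intervals that contain a point of `t` but no point of `t'`. All integers `j` are
counted, so the (possibly truncated) intervals at the two ends of the block are included. -/
noncomputable def unknownCount (L δ : ℕ) (t t' : Finset ℕ) : ℕ :=
  Set.ncard {j : ℤ | MeetsInterval L δ t j ∧ ¬ MeetsInterval L δ t' j}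

/-! Fix a threshold `r`. An interval that meets `S` but not `S'` sticks out of `[1, U]` (at most two
do), or contains more than `r` points of `S`, all of them missing from `S'`, or contains at most `r`
points (`mul_unknownCount_le`). The second kind has expected number at most `ε * m / (r + 1)`.

For the third kind, average over the offset. The left end `l` of such an interval lies in a gap of
`S`, and `[l, l + L)` is covered by this gap and the next `r` gaps. For a given gap, the number of
such `l`, multiplied by `L`, is at most twice the product of the truncated gap with the sum of the
next `r` truncated gaps (`mul_card_leftEnds_le`). Gap weights decay like `g ^ (-3/2)`, so a gap
truncated at `L` has mean of order `√L`, and a product of two such gaps has mean `O(L)`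
(`sum_gapWeight_mul_truncGap_le`). Conditioning on the total length `U` costs only a constant
because `U = O(m ^ 2)`: the ballot numbers `catalanPow (m + 1) q / 4 ^ q` with `q ≤ U - m` are at
most a constant times the value at `q = U - m` (`catalanPow_le_mul`).

With about `m * r` pairs of gaps, the third kind has expected number `O(m * r / L) = O(k * r / m)`.
Taking `r` near `m * √(ε / k)` makes both contributions `O(√(ε * k))`; the logarithm only pays for
the two end intervals. -/

/-! ### Ballot numbers and coefficient bounds for Catalan series. -/

section Ballot

open PowerSeries

/-- The `d`-th coefficient of the `n`-th power of the Catalan generating function. -/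
noncomputable def catalanPow (n d : ℕ) : ℕ := coeff d (catalanSeries ^ n)

lemma catalanPow_zero_succ (d : ℕ) : catalanPow 0 (d + 1) = 0 := by
  simp [catalanPow, coeff_one]

lemma catalanPow_zero_right (n : ℕ) : catalanPow n 0 = 1 := by
  simp [catalanPow]

/-- This is the functional equation `c = 1 + X * c ^ 2` multiplied by `c ^ n`. -/
lemma catalanPow_succ_succ (n d : ℕ) :
    catalanPow (n + 1) (d + 1) = catalanPow n (d + 1) + catalanPow (n + 2) d := by
  have h : catalanSeries ^ (n + 1) = catalanSeries ^ n + catalanSeries ^ (n + 2) * X := by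
    calc catalanSeries ^ (n + 1) = catalanSeries ^ n * (catalanSeries ^ 2 * X + 1) := by
          rw [catalanSeries_sq_mul_X_add_one, pow_succ]
      _ = _ := by ring
  simp only [catalanPow]
  rw [h, map_add, coeff_succ_mul_X]

lemma catalanPow_le_succ (n d : ℕ) : catalanPow n d ≤ catalanPow (n + 1) d := by
  cases d with
  | zero => simp [catalanPow_zero_right]
  | succ d => rw [catalanPow_succ_succ]; exact Nat.le_add_right _ _

lemma catalanPow_mono (d : ℕ) : Monotone fun n => catalanPow n d :=
  monotone_nat_of_le_succ fun n => catalanPow_le_succ n d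

/-- The ballot formula for the powers of the Catalan generating function. -/
lemma catalanPow_mul_factorial (d n : ℕ) :
    catalanPow (n + 1) d * ((d + n + 1).factorial * d.factorial)
      = (n + 1) * (2 * d + n).factorial := by
  -- The recursion reaches `(n + 1, d + 1)` from `(n, d + 1)` and `(n + 2, d)`: hence an outer
  -- induction on `d` for all `n`, and an inner one on `n`.
  induction d generalizing n with
  | zero => simp [catalanPow_zero_right, Nat.factorial_succ]
  | succ d ih =>
    induction n with
    | zero =>
      have h := ih 1
      rw [catalanPow_succ_succ, catalanPow_zero_succ]
      rw [show 2 * (d + 1) + 0 = (2 * d + 1) + 1 by ring, Nat.factorial_succ (2 * d + 1),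
        Nat.factorial_succ d, show d + 1 + 0 + 1 = d + 1 + 1 by ring]
      linear_combination (d + 1) * h
    | succ n ihn =>
      have h := ih (n + 2)
      rw [catalanPow_succ_succ]
      rw [show 2 * (d + 1) + (n + 1) = (2 * d + (n + 2)) + 1 by ring,
        Nat.factorial_succ (2 * d + (n + 2)), Nat.factorial_succ d,
        show d + 1 + (n + 1) + 1 = (d + n + 2) + 1 by ring, Nat.factorial_succ (d + n + 2)]
      rw [show 2 * (d + 1) + n = 2 * d + (n + 2) by ring, Nat.factorial_succ d,
        show d + 1 + n + 1 = d + n + 2 by ring] at ihn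
      rw [show d + (n + 2) + 1 = (d + n + 2) + 1 by ring, Nat.factorial_succ (d + n + 2)] at h
      linear_combination (d + n + 3) * ihn + (d + 1) * h

lemma catalanPow_pos (n d : ℕ) : 0 < catalanPow (n + 1) d := by
  have h := catalanPow_mul_factorial d n
  by_contra h0
  have h1 : catalanPow (n + 1) d = 0 := by omega
  rw [h1, zero_mul] at h
  have := Nat.factorial_pos (2 * d + n)
  have : 0 < (n + 1) * (2 * d + n).factorial := by positivity
  omega

lemma catalanPow_ratio (d n : ℕ) :
    catalanPow (n + 1) (d + 1) * ((d + n + 2) * (d + 1))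
      = catalanPow (n + 1) d * ((2 * d + n + 2) * (2 * d + n + 1)) := by
  have h1 := catalanPow_mul_factorial (d + 1) n
  have h2 := catalanPow_mul_factorial d n
  rw [show d + 1 + n + 1 = (d + n + 1) + 1 by ring, Nat.factorial_succ (d + n + 1),
    Nat.factorial_succ d, show 2 * (d + 1) + n = (2 * d + n + 1) + 1 by ring,
    Nat.factorial_succ (2 * d + n + 1), Nat.factorial_succ (2 * d + n)] at h1
  have h3 : 0 < (d + n + 1).factorial * d.factorial := by positivity
  apply Nat.eq_of_mul_eq_mul_right h3
  linear_combination h1 - (2 * d + n + 2) * (2 * d + n + 1) * h2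

/-- For fixed `n` the normalized coefficients eventually decay like `d ^ (-3/2)`, so the factor `(d
+ n + 1) ^ 2` more than compensates and the product never decreases. -/
lemma sq_mul_catalanPow_step (d n : ℕ) :
    (d + n + 1) ^ 2 * (4 * catalanPow (n + 1) d) ≤ (d + n + 2) ^ 2 * catalanPow (n + 1) (d + 1) := by
  have h := catalanPow_ratio d n
  have h3 : 0 < (d + n + 2) * (d + 1) := by positivity
  refine Nat.le_of_mul_le_mul_right ?_ h3
  have h4 : (d + n + 1) ^ 2 * 4 * ((d + n + 2) * (d + 1)) ≤
      (d + n + 2) ^ 2 * ((2 * d + n + 2) * (2 * d + n + 1)) := by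
    -- The right side minus the left side is `2 d² + (n² + n + 2) d + n² (n + 1)`.
    have h5 : (d + n + 1) ^ 2 * 4 * (d + 1) ≤ (d + n + 2) * ((2 * d + n + 2) * (2 * d + n + 1)) := by
      rcases n with _ | _ | _ | _ | n <;> (zify; ring_nf; nlinarith [sq_nonneg ((d : ℤ)), sq_nonneg ((d : ℤ) - 1)])
    calc _ = (d + n + 2) * ((d + n + 1) ^ 2 * 4 * (d + 1)) := by ring
      _ ≤ (d + n + 2) * ((d + n + 2) * ((2 * d + n + 2) * (2 * d + n + 1))) :=
        Nat.mul_le_mul_left _ h5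
      _ = _ := by ring
  calc _ = catalanPow (n + 1) d * ((d + n + 1) ^ 2 * 4 * ((d + n + 2) * (d + 1))) := by ring
    _ ≤ catalanPow (n + 1) d * ((d + n + 2) ^ 2 * ((2 * d + n + 2) * (2 * d + n + 1))) :=
      Nat.mul_le_mul_left _ h4
    _ = (d + n + 2) ^ 2 * (catalanPow (n + 1) d * ((2 * d + n + 2) * (2 * d + n + 1))) := by ring
    _ = _ := by rw [← h]; ring

/-- In the range `d ≲ n ^ 2 / 6` the normalized coefficients still increase; by `catalanPow_ratio`,
the hypothesis is the expanded form of ratio at least `4`. -/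
lemma catalanPow_step_of_le {d n : ℕ} (hd : 6 * (d + n + 1) ≤ n * (n + 5)) :
    4 * catalanPow (n + 1) d ≤ catalanPow (n + 1) (d + 1) := by
  have h := catalanPow_ratio d n
  have h3 : 0 < (d + n + 2) * (d + 1) := by positivity
  refine Nat.le_of_mul_le_mul_right ?_ h3
  rw [h]
  calc _ = catalanPow (n + 1) d * (4 * ((d + n + 2) * (d + 1))) := by ring
    _ ≤ _ := Nat.mul_le_mul_left _ (by nlinarith)

/-- Up to a constant factor, `catalanPow (n + 1) q / 4 ^ q` is dominated by its value at any later
`d = O(n ^ 2)`. -/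
lemma catalanPow_le_mul {n d : ℕ} {κ : ℝ} (hκ : 1 ≤ κ) (hn : 1 ≤ n)
    (hd : 6 * ((d : ℝ) + n + 1) ≤ κ * (n * (n + 5))) {q : ℕ} (hq : q ≤ d) :
    (catalanPow (n + 1) q : ℝ) / 4 ^ q ≤ κ ^ 2 * ((catalanPow (n + 1) d : ℝ) / 4 ^ d) := by
  have hκ2 : 1 ≤ κ ^ 2 := one_le_pow₀ hκ
  have hmono : Monotone fun e : ℕ => ((e : ℝ) + n + 1) ^ 2 * ((catalanPow (n + 1) e : ℝ) / 4 ^ e) := by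
    refine monotone_nat_of_le_succ fun e => ?_
    have h : (((e + n + 1) ^ 2 * (4 * catalanPow (n + 1) e) : ℕ) : ℝ) ≤
      (((e + n + 2) ^ 2 * catalanPow (n + 1) (e + 1) : ℕ) : ℝ) :=
      Nat.cast_le.2 (sq_mul_catalanPow_step e n)
    push_cast at h ⊢
    rw [← mul_div_assoc, ← mul_div_assoc, div_le_div_iff₀ (by positivity) (by positivity), pow_succ 4 e]
    have := mul_le_mul_of_nonneg_right h (by positivity : (0 : ℝ) ≤ 4 ^ e)
    linear_combination this
  -- Move `q` up towards `d` while the normalized coefficients increase; once they may decrease,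
  -- jump to `d` using `hmono`, losing at most `κ ^ 2`.
  induction hk : d - q generalizing q with
  | zero =>
    obtain rfl : q = d := by omega
    have : (0 : ℝ) ≤ (catalanPow (n + 1) q : ℝ) / 4 ^ q := by positivity
    nlinarith
  | succ k ih =>
    by_cases hs : 6 * (q + n + 1) ≤ n * (n + 5)
    · refine le_trans ?_ (ih (q := q + 1) (by omega) (by omega))
      have h : ((4 * catalanPow (n + 1) q : ℕ) : ℝ) ≤ (catalanPow (n + 1) (q + 1) : ℕ) :=
        Nat.cast_le.2 (catalanPow_step_of_le hs)
      push_cast at h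
      rw [div_le_div_iff₀ (by positivity) (by positivity), pow_succ]
      have := mul_le_mul_of_nonneg_right h (by positivity : (0 : ℝ) ≤ 4 ^ q)
      linarith
    · have h1 : ((n * (n + 5) : ℕ) : ℝ) ≤ ((6 * (q + n + 1) : ℕ) : ℝ) :=
        Nat.cast_le.2 (by omega)
      push_cast at h1
      have h2 : (d : ℝ) + n + 1 ≤ κ * ((q : ℝ) + n + 1) := by nlinarith
      have h3 := hmono hq
      simp only at h3
      have h4 : ((d : ℝ) + n + 1) ^ 2 ≤ κ ^ 2 * ((q : ℝ) + n + 1) ^ 2 := by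
        rw [← mul_pow]; exact pow_le_pow_left₀ (by positivity) h2 2
      have h5 : (0 : ℝ) < ((q : ℝ) + n + 1) ^ 2 := by positivity
      have h6 : (0 : ℝ) ≤ (catalanPow (n + 1) d : ℝ) / 4 ^ d := by positivity
      refine le_of_mul_le_mul_left ?_ h5
      refine h3.trans ?_
      calc _ ≤ _ := mul_le_mul_of_nonneg_right h4 h6
        _ = _ := by ring

/-- Terms below `L` behave like `p ^ (-1/2)` and terms above like `L * p ^ (-3/2)`, so each range
contributes `O(√L)`. With `w p = centralBinom p / 4 ^ p` both ranges telescope: the partial sums of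
`w` are `2 * n * w n`, and `w p / (p + 1) = 2 * (w p - w (p + 1))`. -/
lemma sum_min_mul_catalan_le (L n : ℕ) :
    ∑ p ∈ Finset.range n, ((min (p + 1) L * catalan p : ℕ) : ℝ) / 4 ^ p ≤ 4 * Real.sqrt L := by
  set w : ℕ → ℝ := fun p => (Nat.centralBinom p : ℝ) / 4 ^ p with hw
  have hwpos : ∀ p, 0 ≤ w p := fun p => by positivity
  have hstep : ∀ p : ℕ, 2 * ((p : ℝ) + 1) * w (p + 1) = (2 * p + 1) * w p := by
    intro p
    have h : (((p + 1) * Nat.centralBinom (p + 1) : ℕ) : ℝ) =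
      ((2 * (2 * p + 1) * Nat.centralBinom p : ℕ) : ℝ) := by rw [Nat.succ_mul_centralBinom_succ]
    push_cast at h
    simp only [hw, pow_succ]
    field_simp
    linear_combination 2 * h
  have hcat : ∀ p : ℕ, (catalan p : ℝ) / 4 ^ p = w p / (p + 1) := by
    intro p
    have h : (((p + 1) * catalan p : ℕ) : ℝ) = (Nat.centralBinom p : ℝ) := by
      rw [succ_mul_catalan_eq_centralBinom]
    push_cast at h
    simp only [hw]
    rw [← h]
    field_simp
  have hsq : ∀ p : ℕ, w p ^ 2 * (2 * p + 1) ≤ 1 := by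
    intro p
    induction p with
    | zero => simp [hw]
    | succ p ih =>
      have h := hstep p
      have h1 : w (p + 1) = (2 * p + 1) * w p / (2 * ((p : ℝ) + 1)) := by
        rw [← h]; field_simp
      have h2 : w (p + 1) ^ 2 * (2 * ((p + 1 : ℕ) : ℝ) + 1)
          = (w p ^ 2 * (2 * p + 1)) * ((2 * p + 1) * (2 * p + 3) / (2 * ((p : ℝ) + 1)) ^ 2) := by
        rw [h1]; push_cast; field_simp; ring
      rw [h2]
      refine mul_le_one₀ ih (by positivity) ?_
      rw [div_le_one (by positivity)]
      nlinarith
  have hsum : ∀ n : ℕ, ∑ p ∈ Finset.range n, ((min (p + 1) L * catalan p : ℕ) : ℝ) / 4 ^ p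
      ≤ if n ≤ L then 2 * n * w n else 4 * L * w L - 2 * L * w n := by
    intro n
    induction n with
    | zero => simp
    | succ n ih =>
      rw [Finset.sum_range_succ, Nat.cast_mul, mul_div_assoc, hcat]
      have h := hstep n
      have h1 : w n / ((n : ℝ) + 1) = 2 * (w n - w (n + 1)) := by
        rw [div_eq_iff (by positivity)]; linear_combination h
      rcases lt_trichotomy n L with hn | hn | hn
      · rw [if_pos hn.le] at ih
        rw [if_pos (by omega), min_eq_left (by omega)]
        have h2 : ((n + 1 : ℕ) : ℝ) * (w n / ((n : ℝ) + 1)) = w n := by push_cast; field_simp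
        rw [h2]
        have h3 : ((n + 1 : ℕ) : ℝ) = n + 1 := by push_cast; rfl
        rw [h3]
        linarith
      · subst hn
        rw [if_pos le_rfl] at ih
        rw [if_neg (by omega), min_eq_right (by omega), h1]
        linarith
      · rw [if_neg (by omega)] at ih
        rw [if_neg (by omega), min_eq_right (by omega), h1]
        linarith
  have hfin : 4 * L * w L ≤ 4 * Real.sqrt L := by
    have : L * w L ≤ Real.sqrt L := by
      apply Real.le_sqrt_of_sq_le
      have h := hsq L
      have h0 : (0 : ℝ) ≤ L := by positivity
      nlinarith [sq_nonneg (w L), mul_nonneg h0 (sq_nonneg (w L))]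
    linarith
  refine (hsum n).trans ?_
  split_ifs with hn
  · have : n * w n ≤ Real.sqrt L := by
      apply Real.le_sqrt_of_sq_le
      have h := hsq n
      have h0 : (0 : ℝ) ≤ n := by positivity
      have h1 : (n : ℝ) ≤ L := by exact_mod_cast hn
      nlinarith [sq_nonneg (w n), mul_nonneg h0 (sq_nonneg (w n))]
    nlinarith [Real.sqrt_nonneg (L : ℝ)]
  · have := mul_nonneg (by positivity : (0 : ℝ) ≤ 2 * L) (hwpos n)
    linarith

/-- If the coefficients of `g` up to degree `d` are at most `M * 4 ^ q`, multiplication by `f` costs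
at most a bound for the partial sums of `f (1 / 4)`. -/
lemma coeff_mul_le_of_coeff_le {f g : PowerSeries ℕ} {d : ℕ} {M T : ℝ} (hM : 0 ≤ M)
    (hg : ∀ q ≤ d, ((coeff q g : ℕ) : ℝ) ≤ M * 4 ^ q)
    (hf : ∀ n, ∑ p ∈ Finset.range n, ((coeff p f : ℕ) : ℝ) / 4 ^ p ≤ T) {q : ℕ} (hq : q ≤ d) :
    ((coeff q (f * g) : ℕ) : ℝ) ≤ (T * M) * 4 ^ q := by
  rw [coeff_mul, Nat.cast_sum, Finset.Nat.sum_antidiagonal_eq_sum_range_succ_mk]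
  calc ∑ p ∈ Finset.range q.succ, ((coeff p f * coeff (q - p) g : ℕ) : ℝ)
      ≤ ∑ p ∈ Finset.range q.succ, ((coeff p f : ℕ) : ℝ) / 4 ^ p * (M * 4 ^ q) := by
        refine Finset.sum_le_sum fun p hp => ?_
        have hp' : p ≤ q := Nat.lt_succ_iff.1 (Finset.mem_range.1 hp)
        have h := hg (q - p) (by omega)
        have h4 : (4 : ℝ) ^ q = 4 ^ p * 4 ^ (q - p) := by rw [← pow_add]; congr 1; omega
        rw [h4]
        push_cast
        calc ((coeff p f : ℕ) : ℝ) * ((coeff (q - p) g : ℕ) : ℝ) ≤ ((coeff p f : ℕ) : ℝ) * (M * 4 ^ (q - p)) :=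
              mul_le_mul_of_nonneg_left h (by positivity)
          _ = _ := by field_simp
    _ = (∑ p ∈ Finset.range q.succ, ((coeff p f : ℕ) : ℝ) / 4 ^ p) * (M * 4 ^ q) := by
        rw [Finset.sum_mul]
    _ ≤ T * (M * 4 ^ q) := mul_le_mul_of_nonneg_right (hf _) (by positivity)
    _ = _ := by ring

/-- The generating function of the Catalan numbers `catalan p` weighted by `min (p + 1) L`. -/
noncomputable def truncSeries (L : ℕ) : PowerSeries ℕ :=
  PowerSeries.mk fun p => min (p + 1) L * catalan p

/-- Each truncated factor costs `4 * √L` by `coeff_mul_le_of_coeff_le`. The remaining power `m - 1`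
is compared with `m + 1` by monotonicity in the exponent. -/
lemma coeff_trunc_sq_mul_le {m d L : ℕ} {κ : ℝ} (hκ : 1 ≤ κ) (hm : 1 ≤ m)
    (hd : 6 * ((d : ℝ) + m + 1) ≤ κ * (m * (m + 5))) :
    ((coeff d (truncSeries L * (truncSeries L * catalanSeries ^ (m - 1))) : ℕ) : ℝ)
      ≤ 16 * κ ^ 2 * L * catalanPow (m + 1) d := by
  have hT : ∀ n, ∑ p ∈ Finset.range n, ((coeff p (truncSeries L) : ℕ) : ℝ) / 4 ^ p ≤ 4 * Real.sqrt L := by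
    intro n
    simpa only [truncSeries, coeff_mk] using sum_min_mul_catalan_le L n
  have hM : (0 : ℝ) ≤ κ ^ 2 * ((catalanPow (m + 1) d : ℝ) / 4 ^ d) := by positivity
  have h0 : ∀ q ≤ d, ((coeff q (catalanSeries ^ (m - 1)) : ℕ) : ℝ)
      ≤ κ ^ 2 * ((catalanPow (m + 1) d : ℝ) / 4 ^ d) * 4 ^ q := by
    intro q hq
    have h := catalanPow_le_mul hκ hm hd hq
    rw [div_le_iff₀ (by positivity)] at h
    refine le_trans ?_ h
    exact Nat.cast_le.2 (catalanPow_mono q (by omega : m - 1 ≤ m + 1))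
  have h1 := fun q (hq : q ≤ d) => coeff_mul_le_of_coeff_le hM h0 hT hq
  have h2 := coeff_mul_le_of_coeff_le (by positivity) h1 hT le_rfl
  refine h2.trans (le_of_eq ?_)
  have h3 : Real.sqrt L * Real.sqrt L = L := Real.mul_self_sqrt (by positivity)
  field_simp
  linear_combination (16 * (catalanPow (m + 1) d : ℝ)) * h3

end Ballot

/-! ### Point sequences, their gaps and generating functions. -/

section Sequences

open PowerSeries

lemma mem_pointSeqs {U m : ℕ} {s : Fin (m + 2) → Fin (U + 2)} :
    s ∈ pointSeqs U m ↔ StrictMono s ∧ s 0 = 0 ∧ s (Fin.last (m + 1)) = Fin.last (U + 1) := by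
  simp [pointSeqs]

lemma sum_gaps_add {U m : ℕ} {s : Fin (m + 2) → Fin (U + 2)} (hs : s ∈ pointSeqs U m) :
    ∑ j : Fin (m + 1), ((s j.succ : ℕ) - (s j.castSucc : ℕ) - 1) + m = U := by
  obtain ⟨h1, h0, hl⟩ := mem_pointSeqs.1 hs
  have h2 : ∀ j : Fin (m + 1), (((s j.succ : ℕ) - (s j.castSucc : ℕ) - 1 : ℕ) : ℤ)
      = ((s j.succ : ℕ) : ℤ) - ((s j.castSucc : ℕ) : ℤ) - 1 := by
    intro j
    have h3 : (s j.castSucc : ℕ) < (s j.succ : ℕ) := h1 (Fin.castSucc_lt_succ)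
    omega
  have h4 := Fin.sum_univ_succ fun j : Fin (m + 2) => ((s j : ℕ) : ℤ)
  rw [Fin.sum_univ_castSucc, h0, hl] at h4
  zify
  simp only [h2, Finset.sum_sub_distrib]
  simp only [Fin.val_last, Fin.val_zero] at h4
  simp
  push_cast at h4
  linarith

/-- Weighted sums over point sequences are coefficients of products of power series. -/
lemma sum_pointSeqs_prod {U m : ℕ} (hmU : m ≤ U) (F : Fin (m + 1) → ℕ → ℕ) :
    ∑ s ∈ pointSeqs U m, ∏ j : Fin (m + 1), F j ((s j.succ : ℕ) - (s j.castSucc : ℕ) - 1)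
      = coeff (U - m) (∏ j : Fin (m + 1), PowerSeries.mk (F j)) := by
  rw [coeff_prod]
  refine Finset.sum_nbij
    (fun s => Finsupp.equivFunOnFinite.symm
      fun j : Fin (m + 1) => (s j.succ : ℕ) - (s j.castSucc : ℕ) - 1) ?_ ?_ ?_ ?_
  · intro s hs
    rw [Finset.mem_finsuppAntidiag]
    have := sum_gaps_add hs
    refine ⟨?_, Finset.subset_univ _⟩
    simp only [Finsupp.coe_equivFunOnFinite_symm]
    omega
  · intro s hs s' hs' h
    obtain ⟨h1, h0, -⟩ := mem_pointSeqs.1 hs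
    obtain ⟨h1', h0', -⟩ := mem_pointSeqs.1 hs'
    have h2 := Finsupp.equivFunOnFinite.symm.injective h
    funext i
    induction i using Fin.induction with
    | zero => rw [h0, h0']
    | succ j ih =>
      have h3 := congrFun h2 j
      have h4 : (s j.castSucc : ℕ) < (s j.succ : ℕ) := h1 (Fin.castSucc_lt_succ)
      have h5 : (s' j.castSucc : ℕ) < (s' j.succ : ℕ) := h1' (Fin.castSucc_lt_succ)
      apply Fin.ext
      rw [ih] at h3 h4
      omega
  · intro l hl
    rw [Finset.mem_coe, Finset.mem_finsuppAntidiag] at hl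
    have hl := hl.1
    -- The inverse map: given gaps, the points are the partial sums `T` of the gaps plus one.
    set g : ℕ → ℕ := fun i => if h : i < m + 1 then l ⟨i, h⟩ else 0 with hg
    set T : ℕ → ℕ := fun n => ∑ i ∈ Finset.range n, (g i + 1) with hT
    have hTs : ∀ n, T (n + 1) = T n + (g n + 1) := fun n => Finset.sum_range_succ _ n
    have hTmono : StrictMono T := strictMono_nat_of_lt_succ fun n => by rw [hTs]; omega
    have hTlast : T (m + 1) = U + 1 := by
      have : ∑ i ∈ Finset.range (m + 1), g i = ∑ i : Fin (m + 1), l i := by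
        rw [Finset.sum_range]
        exact Finset.sum_congr rfl fun i _ => by simp only [hg]; rw [dif_pos i.2]
      simp only [hT, Finset.sum_add_distrib, this, hl]
      simp
      omega
    have hTle : ∀ j : Fin (m + 2), T j < U + 2 := fun j => by
      have := hTmono.monotone (Nat.lt_succ_iff.1 j.2)
      omega
    refine ⟨fun j => ⟨T j, hTle j⟩, ?_, ?_⟩
    · rw [Finset.mem_coe, mem_pointSeqs]
      refine ⟨fun i j hij => hTmono hij, ?_, ?_⟩
      · apply Fin.ext; simp [hT]
      · apply Fin.ext; simp [hTlast]
    · ext j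
      have h := hTs j
      simp only [Finsupp.coe_equivFunOnFinite_symm, Fin.val_succ, Fin.val_castSucc, h]
      have : g j = l j := by simp only [hg]; rw [dif_pos j.2]
      omega
  · intro s hs
    simp

lemma totalWeight_eq {U m : ℕ} (hmU : m ≤ U) : totalWeight U m = catalanPow (m + 1) (U - m) := by
  have h := sum_pointSeqs_prod hmU fun _ => catalan
  simp only [Finset.prod_const, Finset.card_univ, Fintype.card_fin] at h
  exact h

lemma totalWeight_pos {U m : ℕ} (hmU : m ≤ U) : 0 < totalWeight U m := by
  rw [totalWeight_eq hmU]; exact catalanPow_pos _ _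

/-- The sequence as a function on `ℕ`, constant after its last term. -/
def extSeq {U m : ℕ} (s : Fin (m + 2) → Fin (U + 2)) (n : ℕ) : ℕ :=
  s ⟨min n (m + 1), by omega⟩

lemma extSeq_of_le {U m : ℕ} (s : Fin (m + 2) → Fin (U + 2)) {n : ℕ} (hn : n < m + 2) :
    extSeq s n = s ⟨n, hn⟩ := by
  unfold extSeq
  congr 3
  omega

/-- The gap after the `i`-th term, truncated at `L`. -/
def truncGap {U m : ℕ} (L : ℕ) (s : Fin (m + 2) → Fin (U + 2)) (i : ℕ) : ℕ :=
  min (extSeq s (i + 1) - extSeq s i) L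

lemma truncGap_eq_zero {U m : ℕ} (L : ℕ) (s : Fin (m + 2) → Fin (U + 2)) {i : ℕ} (hi : m < i) :
    truncGap L s i = 0 := by
  have : extSeq s (i + 1) = extSeq s i := by
    unfold extSeq
    congr 3
    omega
  simp [truncGap, this]

lemma truncGap_fin {U m : ℕ} (L : ℕ) {s : Fin (m + 2) → Fin (U + 2)} (hs : s ∈ pointSeqs U m)
    (i : Fin (m + 1)) :
    truncGap L s i = min ((s i.succ : ℕ) - (s i.castSucc : ℕ) - 1 + 1) L := by
  obtain ⟨h1, -, -⟩ := mem_pointSeqs.1 hs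
  have h3 : (s i.castSucc : ℕ) < (s i.succ : ℕ) := h1 (Fin.castSucc_lt_succ)
  rw [truncGap, extSeq_of_le s (by omega : (i : ℕ) + 1 < m + 2),
    extSeq_of_le s (by omega : (i : ℕ) < m + 2)]
  change min ((s i.succ : ℕ) - (s i.castSucc : ℕ)) L = _
  congr 1
  omega

/-- The second mixed moment of two truncated gaps. -/
lemma sum_gapWeight_mul_truncGap_le {U m L : ℕ} {κ : ℝ} (hκ : 1 ≤ κ) (hm : 1 ≤ m) (hmU : m ≤ U)
    (hU : 6 * ((U : ℝ) + 1) ≤ κ * (m * (m + 5))) {i q : ℕ} (hiq : i < q) :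
    ∑ s ∈ pointSeqs U m, (gapWeight s : ℝ) * (truncGap L s i * truncGap L s q)
      ≤ 16 * κ ^ 2 * L * totalWeight U m := by
  by_cases hq : m < q
  · have : ∀ s ∈ pointSeqs U m, (gapWeight s : ℝ) * (truncGap L s i * truncGap L s q) = 0 := by
      intro s _
      simp [truncGap_eq_zero L s hq]
    rw [Finset.sum_eq_zero this]
    positivity
  obtain ⟨i, rfl⟩ : ∃ i' : Fin (m + 1), (i' : ℕ) = i := ⟨⟨i, by omega⟩, rfl⟩
  obtain ⟨q, rfl⟩ : ∃ q' : Fin (m + 1), (q' : ℕ) = q := ⟨⟨q, by omega⟩, rfl⟩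
  have hne : i ≠ q := fun h => by subst h; omega
  -- The truncation factors are absorbed into the weights of the two distinguished gaps, so that the
  -- weighted sum is again one coefficient of a product of series.
  set F : Fin (m + 1) → ℕ → ℕ := fun j p =>
    (if j = i ∨ j = q then min (p + 1) L else 1) * catalan p with hF
  have h1 : ∀ s ∈ pointSeqs U m, (gapWeight s : ℝ) * (truncGap L s i * truncGap L s q)
      = ((∏ j : Fin (m + 1), F j ((s j.succ : ℕ) - (s j.castSucc : ℕ) - 1) : ℕ) : ℝ) := by
    intro s hs
    rw [truncGap_fin L hs, truncGap_fin L hs]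
    simp only [hF, Finset.prod_mul_distrib]
    rw [Finset.prod_ite, Finset.prod_const_one, mul_one]
    have : (Finset.univ.filter fun j : Fin (m + 1) => j = i ∨ j = q) = {i, q} := by
      ext; simp
    rw [this, Finset.prod_pair hne]
    simp only [gapWeight]
    push_cast
    ring
  rw [Finset.sum_congr rfl h1, ← Nat.cast_sum, sum_pointSeqs_prod hmU, totalWeight_eq hmU]
  have h2 : (∏ j : Fin (m + 1), PowerSeries.mk (F j))
      = truncSeries L * (truncSeries L * catalanSeries ^ (m - 1)) := by
    rw [← Finset.mul_prod_erase _ _ (Finset.mem_univ i),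
      ← Finset.mul_prod_erase _ _ (Finset.mem_erase.2 ⟨hne.symm, Finset.mem_univ q⟩)]
    have hi : PowerSeries.mk (F i) = truncSeries L := by simp [hF, truncSeries]
    have hq : PowerSeries.mk (F q) = truncSeries L := by simp [hF, truncSeries]
    rw [hi, hq]
    congr 2
    rw [Finset.prod_congr rfl (g := fun _ => catalanSeries), Finset.prod_const]
    · congr 1
      rw [Finset.card_erase_of_mem (Finset.mem_erase.2 ⟨hne.symm, Finset.mem_univ q⟩),
        Finset.card_erase_of_mem (Finset.mem_univ i)]
      simp
    · intro j hj
      simp only [Finset.mem_erase] at hj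
      simp [hF, hj.1, hj.2.1, catalanSeries]
  rw [h2]
  refine coeff_trunc_sq_mul_le hκ hm ?_
  rw [Nat.cast_sub hmU]
  linarith

lemma card_pointSet {U m : ℕ} {s : Fin (m + 2) → Fin (U + 2)} (hs : s ∈ pointSeqs U m) :
    (pointSet s).card = m := by
  obtain ⟨h1, -, -⟩ := mem_pointSeqs.1 hs
  rw [pointSet, Finset.card_image_of_injective, Finset.card_univ, Fintype.card_fin]
  intro i j h
  have h2 := h1.injective (Fin.ext h)
  simpa using h2

lemma mem_pointSet_iff {U m : ℕ} {s : Fin (m + 2) → Fin (U + 2)} {x : ℕ} :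
    x ∈ pointSet s ↔ ∃ n, 1 ≤ n ∧ n ≤ m ∧ extSeq s n = x := by
  simp only [pointSet, Finset.mem_image, Finset.mem_univ, true_and]
  constructor
  · rintro ⟨i, rfl⟩
    exact ⟨i + 1, by omega, by omega, by rw [extSeq_of_le s (by omega)]; rfl⟩
  · rintro ⟨n, h1, h2, rfl⟩
    refine ⟨⟨n - 1, by omega⟩, ?_⟩
    rw [extSeq_of_le s (by omega)]
    congr 2
    apply Fin.ext
    simp
    omega

lemma extSeq_strictMonoOn {U m : ℕ} {s : Fin (m + 2) → Fin (U + 2)} (hs : s ∈ pointSeqs U m) :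
    StrictMonoOn (extSeq s) (Set.Iic (m + 1)) := by
  intro a ha b hb hab
  simp only [Set.mem_Iic] at ha hb
  rw [extSeq_of_le s (by omega), extSeq_of_le s (by omega)]
  exact (mem_pointSeqs.1 hs).1 hab

lemma extSeq_monotone {U m : ℕ} {s : Fin (m + 2) → Fin (U + 2)} (hs : s ∈ pointSeqs U m) :
    Monotone (extSeq s) := by
  intro a b hab
  refine (mem_pointSeqs.1 hs).1.monotone ?_
  simp only [Fin.mk_le_mk]
  omega

lemma extSeq_zero {U m : ℕ} {s : Fin (m + 2) → Fin (U + 2)} (hs : s ∈ pointSeqs U m) :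
    extSeq s 0 = 0 := by
  have := (mem_pointSeqs.1 hs).2.1
  rw [extSeq_of_le s (by omega)]
  exact congrArg Fin.val this

lemma extSeq_last {U m : ℕ} {s : Fin (m + 2) → Fin (U + 2)} (hs : s ∈ pointSeqs U m) {n : ℕ}
    (hn : m + 1 ≤ n) : extSeq s n = U + 1 := by
  have h := (mem_pointSeqs.1 hs).2.2
  have h2 : extSeq s n = (s (Fin.last (m + 1)) : ℕ) := by
    unfold extSeq
    congr 2
    apply Fin.ext
    simp
    omega
  rw [h2, h]
  rfl

/-- A finite set has only one increasing enumeration. This allows sums over point sets to be taken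
over sequences. -/
lemma pointSet_injOn {U m : ℕ} :
    Set.InjOn (pointSet (U := U) (m := m)) (pointSeqs U m : Set (Fin (m + 2) → Fin (U + 2))) := by
  intro s hs s' hs' h
  obtain ⟨-, h0, hl⟩ := mem_pointSeqs.1 hs
  obtain ⟨-, h0', hl'⟩ := mem_pointSeqs.1 hs'
  have key : ∀ {s : Fin (m + 2) → Fin (U + 2)}, s ∈ pointSeqs U m →
      StrictMono fun i : Fin m => (s i.castSucc.succ : ℕ) := by
    intro s hs i j hij
    exact (mem_pointSeqs.1 hs).1 (by simpa using hij)
  have e := (Finset.orderEmbOfFin_unique (card_pointSet hs)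
    (f := fun i : Fin m => (s i.castSucc.succ : ℕ))
    (fun i => Finset.mem_image_of_mem _ (Finset.mem_univ i)) (key hs))
  have e' := (Finset.orderEmbOfFin_unique (card_pointSet hs)
    (f := fun i : Fin m => (s' i.castSucc.succ : ℕ))
    (fun i => by rw [h]; exact Finset.mem_image_of_mem _ (Finset.mem_univ i)) (key hs'))
  have hee := e.trans e'.symm
  funext j
  induction j using Fin.cases with
  | zero => rw [h0, h0']
  | succ j =>
    induction j using Fin.lastCases with
    | last => rw [Fin.succ_last, hl, hl']
    | cast i => exact Fin.ext (congrFun hee i)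

end Sequences

/-! ### Deterministic counting of intervals. -/

section Blocks

/-- The index `j` of the interval `[δ + j L, δ + (j + 1) L)` that contains `x`. -/
def blockIndex (L δ x : ℕ) : ℤ := ((x : ℤ) - δ) / L

lemma blockIndex_eq_iff {L δ x : ℕ} (hL : 0 < L) {j : ℤ} :
    blockIndex L δ x = j ↔ (δ : ℤ) + j * L ≤ (x : ℤ) ∧ (x : ℤ) < (δ : ℤ) + (j + 1) * L := by
  have hL' : (0 : ℤ) < L := by exact_mod_cast hL
  rw [blockIndex, le_antisymm_iff, Int.le_ediv_iff_mul_le hL', ← Int.lt_add_one_iff,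
    Int.ediv_lt_iff_lt_mul hL']
  constructor <;> rintro ⟨h1, h2⟩ <;> constructor <;> linarith

lemma meetsInterval_iff {L δ : ℕ} (hL : 0 < L) {t : Finset ℕ} {j : ℤ} :
    MeetsInterval L δ t j ↔ j ∈ t.image (blockIndex L δ) := by
  simp only [MeetsInterval, Finset.mem_image, blockIndex_eq_iff hL]

lemma unknownCount_eq {L δ : ℕ} (hL : 0 < L) (t t' : Finset ℕ) :
    unknownCount L δ t t' = (t.image (blockIndex L δ) \ t'.image (blockIndex L δ)).card := by
  rw [unknownCount, ← Set.ncard_coe_finset]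
  congr 1
  ext j
  simp only [Set.mem_ofPred_eq, meetsInterval_iff hL, Finset.coe_sdiff, Set.mem_sdiff,
    Finset.mem_coe]

lemma unknownCount_le_card_sdiff {L δ : ℕ} (hL : 0 < L) (t t' : Finset ℕ) :
    unknownCount L δ t t' ≤ (t \ t').card := by
  rw [unknownCount_eq hL]
  refine le_trans (Finset.card_le_card ?_) (Finset.card_image_le (f := blockIndex L δ))
  intro j hj
  simp only [Finset.mem_sdiff, Finset.mem_image, not_exists, not_and] at hj ⊢
  obtain ⟨⟨x, hx, rfl⟩, h⟩ := hj
  exact ⟨x, ⟨hx, fun hx' => h x hx' rfl⟩, rfl⟩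

/-- The intervals inside `[1, U]` that contain at least one and at most `r` points of `t`. -/
def fewBlocks (L δ U r : ℕ) (t : Finset ℕ) : Finset ℤ :=
  (t.image (blockIndex L δ)).filter fun j =>
    1 ≤ (δ : ℤ) + j * L ∧ (δ : ℤ) + (j + 1) * L ≤ U + 1 ∧
      (t.filter fun x => blockIndex L δ x = j).card ≤ r

/-- A counted interval with at least `r + 1` points of `t` uses up `r + 1` points of `t \ t'`, and
distinct intervals use disjoint sets of points. The `2` counts intervals not contained in `[1, U]`.
-/
lemma mul_unknownCount_le {L δ U r : ℕ} {t t' : Finset ℕ} (ht : t ⊆ Finset.Icc 1 U)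
    (hδ : δ ∈ Finset.Icc 1 L) :
    (r + 1) * unknownCount L δ t t'
      ≤ (r + 1) * ((fewBlocks L δ U r t).card + 2) + (t \ t').card := by
  rw [Finset.mem_Icc] at hδ
  have hL : 0 < L := by omega
  have hL' : (0 : ℤ) < L := by exact_mod_cast hL
  rw [unknownCount_eq hL]
  set A := t.image (blockIndex L δ) \ t'.image (blockIndex L δ) with hA
  set B := A.filter fun j => r + 1 ≤ (t.filter fun x => blockIndex L δ x = j).card with hB
  -- Since `1 ≤ δ ≤ L`, the only interval with a point of `[1, U]` that starts before `1` has index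
  -- `-1`; one that ends beyond `U` must contain `U`.
  have hsub : A ⊆ (fewBlocks L δ U r t ∪ {-1, blockIndex L δ U}) ∪ B := by
    intro j hj
    have hj1 := (Finset.mem_sdiff.1 hj).1
    obtain ⟨x, hx, hxj⟩ := Finset.mem_image.1 hj1
    have hxj' := (blockIndex_eq_iff hL).1 hxj
    have hxU := Finset.mem_Icc.1 (ht hx)
    simp only [Finset.mem_union, Finset.mem_insert, Finset.mem_singleton]
    by_cases hB' : r + 1 ≤ (t.filter fun x => blockIndex L δ x = j).card
    · exact Or.inr (Finset.mem_filter.2 ⟨hj, hB'⟩)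
    left
    by_cases h1 : 1 ≤ (δ : ℤ) + j * L
    · by_cases h2 : (δ : ℤ) + (j + 1) * L ≤ U + 1
      · left
        exact Finset.mem_filter.2 ⟨hj1, h1, h2, by omega⟩
      · right; right
        symm
        rw [blockIndex_eq_iff hL]
        constructor <;> omega
    · right; left
      have h3 : j < 0 := by
        by_contra h
        have : 0 ≤ j * L := mul_nonneg (by omega) hL'.le
        omega
      have h4 : -2 < j := by
        by_contra h
        have : (j + 1) * L ≤ (-1) * L := mul_le_mul_of_nonneg_right (by omega) hL'.le
        omega
      omega
  have hBcard : (r + 1) * B.card ≤ (t \ t').card := by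
    have h1 : B.card * (r + 1) ≤ ∑ j ∈ B, (t.filter fun x => blockIndex L δ x = j).card := by
      rw [← smul_eq_mul]
      exact Finset.card_nsmul_le_sum _ _ _ fun j hj => (Finset.mem_filter.1 hj).2
    have h2 : ∑ j ∈ B, (t.filter fun x => blockIndex L δ x = j).card
        = ∑ j ∈ B, ((t \ t').filter fun x => blockIndex L δ x = j).card := by
      refine Finset.sum_congr rfl fun j hj => ?_
      congr 1
      ext x
      simp only [Finset.mem_filter, Finset.mem_sdiff]
      have h3 := (Finset.mem_sdiff.1 (Finset.mem_filter.1 hj).1).2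
      constructor
      · rintro ⟨hx, hxj⟩
        exact ⟨⟨hx, fun hx' => h3 (Finset.mem_image.2 ⟨x, hx', hxj⟩)⟩, hxj⟩
      · rintro ⟨⟨hx, -⟩, hxj⟩
        exact ⟨hx, hxj⟩
    have h3 : ∑ j ∈ B, ((t \ t').filter fun x => blockIndex L δ x = j).card ≤ (t \ t').card := by
      rw [← Finset.card_biUnion]
      · exact Finset.card_le_card (Finset.biUnion_subset.2 fun j _ => Finset.filter_subset _ _)
      · intro i _ j _ hij
        exact Finset.disjoint_filter.2 fun x _ h h' => hij (h.symm.trans h')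
    calc (r + 1) * B.card = B.card * (r + 1) := mul_comm _ _
      _ ≤ _ := h1.trans (h2.le.trans h3)
  have hcard : A.card ≤ (fewBlocks L δ U r t).card + 2 + B.card := by
    refine (Finset.card_le_card hsub).trans ((Finset.card_union_le _ _).trans ?_)
    refine Nat.add_le_add_right ((Finset.card_union_le _ _).trans ?_) _
    exact Nat.add_le_add_left Finset.card_le_two _
  calc (r + 1) * A.card ≤ (r + 1) * ((fewBlocks L δ U r t).card + 2 + B.card) :=
        Nat.mul_le_mul_left _ hcard
    _ = (r + 1) * ((fewBlocks L δ U r t).card + 2) + (r + 1) * B.card := by ring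
    _ ≤ _ := Nat.add_le_add_left hBcard _

/-- The left endpoints `l` in the gap `(σ i, σ (i + 1)]` for which `[l, l + L)` contains
`σ (i + 1)` and ends at or before `σ (i + 1 + r)`. -/
noncomputable def leftEnds (σ : ℕ → ℕ) (L r i : ℕ) : Finset ℤ :=
  (Finset.Ioc (σ i : ℤ) (σ (i + 1))).filter fun l =>
    (σ (i + 1) : ℤ) < l + L ∧ l + L ≤ σ (i + 1 + r)

/-- Subadditivity of `x ↦ min x L`. -/
lemma min_sub_le_sum {σ : ℕ → ℕ} (hσ : Monotone σ) (L n r : ℕ) :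
    min (σ (n + r) - σ n) L ≤ ∑ k ∈ Finset.range r, min (σ (n + k + 1) - σ (n + k)) L := by
  induction r with
  | zero => simp
  | succ r ih =>
    rw [Finset.sum_range_succ]
    have h1 := hσ (by omega : n ≤ n + r)
    have h2 := hσ (by omega : n + r ≤ n + r + 1)
    rw [show n + (r + 1) = n + r + 1 by ring]
    omega

/-- Let `G` and `H` be the truncated distances from `σ (i + 1)` back to `σ i` and forward to `σ (i +
1 + r)`. If some window fits, then `L ≤ G + H`; the number of windows is at most `G` and at most
`H`, so `L` times it is at most `2 * G * H`. -/
lemma mul_card_leftEnds_le {σ : ℕ → ℕ} (hσ : Monotone σ) (L r i : ℕ) :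
    L * (leftEnds σ L r i).card ≤ 2 * (min (σ (i + 1) - σ i) L *
      ∑ k ∈ Finset.range r, min (σ (i + 1 + k + 1) - σ (i + 1 + k)) L) := by
  rcases (leftEnds σ L r i).eq_empty_or_nonempty with h | ⟨l, hl⟩
  · simp [h]
  simp only [leftEnds, Finset.mem_filter, Finset.mem_Ioc] at hl
  have h1 := hσ (by omega : i ≤ i + 1)
  have h2 := hσ (by omega : i + 1 ≤ i + 1 + r)
  set G := min (σ (i + 1) - σ i) L with hG
  set H := min (σ (i + 1 + r) - σ (i + 1)) L with hH
  have hGH : L ≤ G + H := by omega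
  have hcG : (leftEnds σ L r i).card ≤ G := by
    have : leftEnds σ L r i ⊆ Finset.Ioc ((σ (i + 1) : ℤ) - G) (σ (i + 1)) := by
      intro x hx
      simp only [leftEnds, Finset.mem_filter, Finset.mem_Ioc] at hx ⊢
      omega
    refine (Finset.card_le_card this).trans ?_
    rw [Int.card_Ioc]
    omega
  have hcH : (leftEnds σ L r i).card ≤ H := by
    have : leftEnds σ L r i ⊆ Finset.Ioc ((σ (i + 1) : ℤ) - L) (σ (i + 1) - L + H) := by
      intro x hx
      simp only [leftEnds, Finset.mem_filter, Finset.mem_Ioc] at hx ⊢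
      omega
    refine (Finset.card_le_card this).trans ?_
    rw [Int.card_Ioc]
    omega
  have hHs := min_sub_le_sum hσ L (i + 1) r
  calc L * (leftEnds σ L r i).card ≤ (G + H) * (leftEnds σ L r i).card :=
        Nat.mul_le_mul_right _ hGH
    _ = G * (leftEnds σ L r i).card + H * (leftEnds σ L r i).card := by ring
    _ ≤ G * H + H * G := by gcongr
    _ = 2 * (G * H) := by ring
    _ ≤ _ := by gcongr

/-- Summed over the offsets, the number of intervals with few points is controlled by products of
two truncated gaps at distance at most `r`. -/
lemma mul_sum_card_fewBlocks_le {U m L r : ℕ} (hr : 1 ≤ r) {s : Fin (m + 2) → Fin (U + 2)}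
    (hs : s ∈ pointSeqs U m) :
    L * ∑ δ ∈ Finset.Icc 1 L, (fewBlocks L δ U r (pointSet s)).card
      ≤ 2 * ∑ i ∈ Finset.range (m + 1), ∑ k ∈ Finset.range r,
          truncGap L s i * truncGap L s (i + 1 + k) := by
  have hmono := extSeq_monotone hs
  have hstrict := extSeq_strictMonoOn hs
  set σ := extSeq s with hσ
  have h1 : ∑ δ ∈ Finset.Icc 1 L, (fewBlocks L δ U r (pointSet s)).card
      ≤ ((Finset.range (m + 1)).biUnion fun i => leftEnds σ L r i).card := by
    rw [← Finset.card_sigma]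
    -- An offset and an index are recovered from the left end `δ + j * L` by division with
    -- remainder, so averaging over offsets counts each left end once.
    refine Finset.card_le_card_of_injOn (fun p => (p.1 : ℤ) + p.2 * L) ?_ ?_
    · rintro ⟨δ, j⟩ hp
      rw [Finset.mem_coe, Finset.mem_sigma, Finset.mem_Icc] at hp
      obtain ⟨⟨hδ1, hδ2⟩, hj⟩ := hp
      have hL : 0 < L := by simp only at hδ1 hδ2; omega
      simp only [fewBlocks, Finset.mem_filter, Finset.mem_image] at hj
      obtain ⟨⟨x, hx, hxj⟩, hlo, hhi, hcard⟩ := hj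
      rw [blockIndex_eq_iff hL] at hxj
      obtain ⟨n, hn1, hnm, rfl⟩ := mem_pointSet_iff.1 hx
      rw [← hσ] at hxj
      simp only [Finset.coe_biUnion, Set.mem_iUnion, Finset.mem_coe, Finset.mem_range,
        exists_prop]
      set l : ℤ := (δ : ℤ) + j * L with hl
      have hlL : (δ : ℤ) + (j + 1) * L = l + L := by rw [hl]; ring
      rw [hlL] at hhi hxj
      have hex : ∃ n, l ≤ (σ n : ℤ) := ⟨n, hxj.1⟩
      classical
      set q := Nat.find hex with hq
      have hq1 : l ≤ (σ q : ℤ) := Nat.find_spec hex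
      -- `σ q` is the first term at or after `l`, so `l` lies in the gap that ends there.
      have hqn : q ≤ n := Nat.find_min' hex hxj.1
      have hq0 : q ≠ 0 := by
        intro h0
        rw [h0, hσ, extSeq_zero hs] at hq1
        push_cast at hq1
        omega
      have hqlt : ¬ l ≤ (σ (q - 1) : ℤ) := Nat.find_min hex (by omega)
      have hqle : σ q ≤ σ n := hmono hqn
      refine ⟨q - 1, by omega, ?_⟩
      have hq' : q - 1 + 1 = q := by omega
      simp only [leftEnds, hq', Finset.mem_filter, Finset.mem_Ioc]
      refine ⟨⟨by omega, hq1⟩, by omega, ?_⟩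
      -- Otherwise `σ q, ..., σ (q + r)` all lie in the interval. As it ends by `U + 1`, none is the
      -- final sentinel, so they are `r + 1` points of the set.
      by_contra hcon
      have hqr : q + r ≤ m := by
        by_contra hcon'
        have := extSeq_last hs (by omega : m + 1 ≤ q + r)
        rw [← hσ] at this
        omega
      have hsub : (Finset.Icc q (q + r)).image σ
          ⊆ (pointSet s).filter fun x => blockIndex L δ x = j := by
        intro y hy
        obtain ⟨a, ha, rfl⟩ := Finset.mem_image.1 hy
        rw [Finset.mem_Icc] at ha
        rw [Finset.mem_filter, blockIndex_eq_iff hL, hlL]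
        have ha1 := hmono ha.1
        have ha2 := hmono ha.2
        exact ⟨mem_pointSet_iff.2 ⟨a, by omega, by omega, rfl⟩, by omega, by omega⟩
      have hc := Finset.card_le_card hsub
      rw [Finset.card_image_of_injOn, Nat.card_Icc] at hc
      · omega
      · refine hstrict.injOn.mono ?_
        intro a ha
        rw [Finset.mem_coe, Finset.mem_Icc] at ha
        simp only [Set.mem_Iic]
        omega
    · rintro ⟨δ, j⟩ hp ⟨δ', j'⟩ hp' h
      rw [Finset.mem_coe, Finset.mem_sigma, Finset.mem_Icc] at hp hp'
      obtain ⟨⟨hδ1, hδ2⟩, -⟩ := hp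
      obtain ⟨⟨hδ1', hδ2'⟩, -⟩ := hp'
      simp only at h hδ1 hδ2 hδ1' hδ2'
      have hL : 0 < L := by omega
      have hL' : (0 : ℤ) < L := by exact_mod_cast hL
      have hjj : j = j' := by
        rcases lt_trichotomy j j' with hlt | heq | hlt
        · have : (j + 1) * L ≤ j' * L := mul_le_mul_of_nonneg_right (by omega) hL'.le
          rw [add_mul] at this
          omega
        · exact heq
        · have : (j' + 1) * L ≤ j * L := mul_le_mul_of_nonneg_right (by omega) hL'.le
          rw [add_mul] at this
          omega
      subst hjj
      have : δ = δ' := by omega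
      rw [this]
  calc _ ≤ L * ∑ i ∈ Finset.range (m + 1), (leftEnds σ L r i).card :=
        Nat.mul_le_mul_left _ (h1.trans Finset.card_biUnion_le)
    _ = ∑ i ∈ Finset.range (m + 1), L * (leftEnds σ L r i).card := Finset.mul_sum _ _ _
    _ ≤ ∑ i ∈ Finset.range (m + 1), 2 * (min (σ (i + 1) - σ i) L *
          ∑ k ∈ Finset.range r, min (σ (i + 1 + k + 1) - σ (i + 1 + k)) L) :=
        Finset.sum_le_sum fun i _ => mul_card_leftEnds_le hmono L r i
    _ = _ := by
        simp only [Finset.mul_sum, truncGap, hσ]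

end Blocks

/-! ### From finite sums to expectations. -/

section Probability

/-- The average number of intervals with few points, as a finite sum. -/
lemma sum_gapWeight_mul_card_fewBlocks_le {U m L r : ℕ} {κ : ℝ} (hκ : 1 ≤ κ) (hm : 1 ≤ m)
    (hmU : m ≤ U) (hU : 6 * ((U : ℝ) + 1) ≤ κ * (m * (m + 5))) (hL : 0 < L) (hr : 1 ≤ r) :
    ∑ s ∈ pointSeqs U m, (gapWeight s : ℝ) *
        ∑ δ ∈ Finset.Icc 1 L, ((fewBlocks L δ U r (pointSet s)).card : ℝ)
      ≤ 32 * κ ^ 2 * (m + 1) * r * totalWeight U m := by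
  have hL' : (0 : ℝ) < L := by exact_mod_cast hL
  refine le_of_mul_le_mul_left ?_ hL'
  calc L * ∑ s ∈ pointSeqs U m, (gapWeight s : ℝ) *
        ∑ δ ∈ Finset.Icc 1 L, ((fewBlocks L δ U r (pointSet s)).card : ℝ)
      = ∑ s ∈ pointSeqs U m, (gapWeight s : ℝ) *
        (L * ∑ δ ∈ Finset.Icc 1 L, ((fewBlocks L δ U r (pointSet s)).card : ℝ)) := by
        rw [Finset.mul_sum]
        exact Finset.sum_congr rfl fun s _ => by ring
    _ ≤ ∑ s ∈ pointSeqs U m, (gapWeight s : ℝ) * (2 * ∑ i ∈ Finset.range (m + 1),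
          ∑ k ∈ Finset.range r, ((truncGap L s i : ℝ) * truncGap L s (i + 1 + k))) := by
        refine Finset.sum_le_sum fun s hs => mul_le_mul_of_nonneg_left ?_ (by positivity)
        exact_mod_cast mul_sum_card_fewBlocks_le hr hs
    _ = 2 * ∑ i ∈ Finset.range (m + 1), ∑ k ∈ Finset.range r, ∑ s ∈ pointSeqs U m,
          (gapWeight s : ℝ) * (truncGap L s i * truncGap L s (i + 1 + k)) := by
        have h : ∀ i ∈ Finset.range (m + 1), ∑ k ∈ Finset.range r, ∑ s ∈ pointSeqs U m,
            (gapWeight s : ℝ) * (truncGap L s i * truncGap L s (i + 1 + k))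
            = ∑ s ∈ pointSeqs U m, ∑ k ∈ Finset.range r,
            (gapWeight s : ℝ) * (truncGap L s i * truncGap L s (i + 1 + k)) :=
          fun i _ => Finset.sum_comm
        rw [Finset.sum_congr rfl h, Finset.sum_comm, Finset.mul_sum]
        refine Finset.sum_congr rfl fun s _ => ?_
        simp only [Finset.mul_sum]
        exact Finset.sum_congr rfl fun i _ => Finset.sum_congr rfl fun k _ => by ring
    _ ≤ 2 * ∑ _i ∈ Finset.range (m + 1), ∑ _k ∈ Finset.range r,
          16 * κ ^ 2 * L * totalWeight U m := by
        refine mul_le_mul_of_nonneg_left ?_ zero_le_two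
        exact Finset.sum_le_sum fun i _ => Finset.sum_le_sum fun k _ =>
          sum_gapWeight_mul_truncGap_le hκ hm hmU hU (by omega)
    _ = L * (32 * κ ^ 2 * (m + 1) * r * totalWeight U m) := by
        simp only [Finset.sum_const, Finset.card_range, nsmul_eq_mul]
        push_cast
        ring

variable {Ω : Type*} [MeasurableSpace Ω]

lemma DiscreteRV.measurable_comp {α : Type*} [Countable α] {X : Ω → α} (hX : DiscreteRV X)
    (F : α → ℝ) : Measurable fun ω => F (X ω) := by
  let _ : MeasurableSpace α := ⊤
  have h : Measurable X := measurable_to_countable' hX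
  exact (measurable_from_top (f := F)).comp h

lemma DiscreteRV.prodMk {α β : Type*} {X : Ω → α} {Y : Ω → β} (hX : DiscreteRV X)
    (hY : DiscreteRV Y) : DiscreteRV fun ω => (X ω, Y ω) := by
  rintro ⟨a, b⟩
  have : {ω | (X ω, Y ω) = (a, b)} = {ω | X ω = a} ∩ {ω | Y ω = b} := by
    ext ω; simp
  rw [this]
  exact (hX a).inter (hY b)

lemma DiscreteRV.ae_mem_of_sum_eq_one {α : Type*} {P : Measure Ω} [IsProbabilityMeasure P]
    {X : Ω → α} (hX : DiscreteRV X) {T : Finset α} (hT : ∑ x ∈ T, P {ω | X ω = x} = 1) :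
    ∀ᵐ ω ∂P, X ω ∈ T := by
  have hU : {ω | X ω ∈ T} = ⋃ x ∈ T, {ω | X ω = x} := by
    ext ω; simp
  have hms : MeasurableSet {ω | X ω ∈ T} := by
    rw [hU]; exact Finset.measurableSet_biUnion _ fun x _ => hX x
  have h1 : P {ω | X ω ∈ T} = 1 := by
    rw [hU, measure_biUnion_finset _ fun x _ => hX x, hT]
    intro x _ y _ hxy
    exact Set.disjoint_left.2 fun ω h h' => hxy (h.symm.trans h')
  exact (prob_compl_eq_zero_iff hms).2 h1

lemma DiscreteRV.integral_comp_eq {α : Type*} {P : Measure Ω} [IsProbabilityMeasure P]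
    {X : Ω → α} (hX : DiscreteRV X) {T : Finset α} (hT : ∀ᵐ ω ∂P, X ω ∈ T) (F : α → ℝ) :
    Integrable (fun ω => F (X ω)) P ∧
      ∫ ω, F (X ω) ∂P = ∑ x ∈ T, P.real {ω | X ω = x} * F x := by
  classical
  have hae : (fun ω => F (X ω)) =ᵐ[P] fun ω => ∑ x ∈ T, {ω | X ω = x}.indicator (fun _ => F x) ω := by
    filter_upwards [hT] with ω hω
    rw [Finset.sum_eq_single (X ω)]
    · simp
    · intro x _ hx
      exact Set.indicator_of_notMem (fun h => hx (Eq.symm h)) _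
    · exact fun h => absurd hω h
  have hint : ∀ x ∈ T, Integrable ({ω | X ω = x}.indicator fun _ => F x) P :=
    fun x _ => (integrable_const _).indicator (hX x)
  refine ⟨(integrable_finsetSum T hint).congr hae.symm, ?_⟩
  rw [integral_congr_ae hae, integral_finsetSum T hint]
  refine Finset.sum_congr rfl fun x _ => ?_
  rw [integral_indicator_const _ (hX x), smul_eq_mul]

/-- The law prescribes only the probabilities of admissible sets; they sum to one, which leaves no
mass elsewhere. -/
lemma HasCatalanLaw.ae_mem {P : Measure Ω} [IsProbabilityMeasure P] {U m : ℕ} (hmU : m ≤ U)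
    {S : Ω → Finset ℕ} (hS : DiscreteRV S) (h : HasCatalanLaw P U m S) :
    ∀ᵐ ω ∂P, S ω ∈ (pointSeqs U m).image pointSet := by
  refine hS.ae_mem_of_sum_eq_one ?_
  have hpos : (0 : ℝ) < totalWeight U m := by exact_mod_cast totalWeight_pos hmU
  rw [Finset.sum_image pointSet_injOn, Finset.sum_congr rfl h,
    ← ENNReal.ofReal_sum_of_nonneg fun s _ => by positivity, ← Finset.sum_div, ← Nat.cast_sum]
  have : ((∑ s ∈ pointSeqs U m, gapWeight s : ℕ) : ℝ) = totalWeight U m := rfl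
  rw [this, div_self hpos.ne', ENNReal.ofReal_one]

lemma IsUniformOffset.ae_mem {P : Measure Ω} [IsProbabilityMeasure P] {L : ℕ} (hL : 0 < L)
    {Δ : Ω → ℕ} (hΔ : DiscreteRV Δ) (h : IsUniformOffset P L Δ) :
    ∀ᵐ ω ∂P, Δ ω ∈ Finset.Icc 1 L := by
  refine hΔ.ae_mem_of_sum_eq_one ?_
  have hL' : (0 : ℝ) < L := by exact_mod_cast hL
  rw [Finset.sum_congr rfl h, ← ENNReal.ofReal_sum_of_nonneg fun s _ => by positivity]
  simp [hL'.ne']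

/-- Independence gives each pair `(pointSet s, δ)` mass `gapWeight s / (totalWeight U m * L)`, which
reduces the claim to `sum_gapWeight_mul_card_fewBlocks_le`. -/
lemma integral_card_fewBlocks_le {P : Measure Ω} [IsProbabilityMeasure P] {U m L r : ℕ} {κ : ℝ}
    (hκ : 1 ≤ κ) (hm : 1 ≤ m) (hmU : m ≤ U) (hU : 6 * ((U : ℝ) + 1) ≤ κ * (m * (m + 5)))
    (hL : 0 < L) (hr : 1 ≤ r) {S : Ω → Finset ℕ} {Δ : Ω → ℕ} (hS : DiscreteRV S)
    (hΔ : DiscreteRV Δ) (hlaw : HasCatalanLaw P U m S) (hunif : IsUniformOffset P L Δ)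
    (hind : DiscreteIndep P S Δ) :
    Integrable (fun ω => ((fewBlocks L (Δ ω) U r (S ω)).card : ℝ)) P ∧
      ∫ ω, ((fewBlocks L (Δ ω) U r (S ω)).card : ℝ) ∂P ≤ 32 * κ ^ 2 * (m + 1) * r / L := by
  have hpos : (0 : ℝ) < totalWeight U m := by exact_mod_cast totalWeight_pos hmU
  have hL' : (0 : ℝ) < L := by exact_mod_cast hL
  have hmem : ∀ᵐ ω ∂P, (S ω, Δ ω) ∈ (pointSeqs U m).image pointSet ×ˢ Finset.Icc 1 L := by
    filter_upwards [hlaw.ae_mem hmU hS, hunif.ae_mem hL hΔ] with ω h1 h2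
    exact Finset.mem_product.2 ⟨h1, h2⟩
  obtain ⟨hi, he⟩ := (hS.prodMk hΔ).integral_comp_eq hmem
    fun x : Finset ℕ × ℕ => ((fewBlocks L x.2 U r x.1).card : ℝ)
  refine ⟨hi, ?_⟩
  rw [he, Finset.sum_product, Finset.sum_image pointSet_injOn]
  have hterm : ∀ s ∈ pointSeqs U m, ∑ δ ∈ Finset.Icc 1 L,
      P.real {ω | (S ω, Δ ω) = (pointSet s, δ)} * ((fewBlocks L δ U r (pointSet s)).card : ℝ)
      = (gapWeight s : ℝ) * (∑ δ ∈ Finset.Icc 1 L, ((fewBlocks L δ U r (pointSet s)).card : ℝ))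
        * (1 / (totalWeight U m * L)) := by
    intro s hs
    rw [Finset.mul_sum, Finset.sum_mul]
    refine Finset.sum_congr rfl fun δ hδ => ?_
    have : P.real {ω | (S ω, Δ ω) = (pointSet s, δ)}
        = (gapWeight s : ℝ) / totalWeight U m * (1 / L) := by
      simp only [Prod.mk.injEq]
      rw [measureReal_def, hind, ENNReal.toReal_mul, hlaw s hs, hunif δ hδ,
        ENNReal.toReal_ofReal (by positivity), ENNReal.toReal_ofReal (by positivity)]
    rw [this]
    field_simp
  rw [Finset.sum_congr rfl hterm, ← Finset.sum_mul, mul_one_div, div_le_div_iff₀ (by positivity) hL']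
  have := sum_gapWeight_mul_card_fewBlocks_le hκ hm hmU hU hL hr
  calc _ ≤ (32 * κ ^ 2 * (m + 1) * r * totalWeight U m) * L :=
        mul_le_mul_of_nonneg_right this hL'.le
    _ = _ := by ring

end Probability

/-! ### Choice of the threshold and conclusion. -/

theorem mainTheorem7 (a b : ℝ) (ha : 0 < a) (hab : a ≤ b) :
    ∃ C : ℝ, 0 < C ∧
      ∀ (m U L : ℕ) (k ε : ℝ), 1 ≤ m → m ≤ U →
        a * (m : ℝ) ^ 2 ≤ (U : ℝ) → (U : ℝ) ≤ b * (m : ℝ) ^ 2 →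
        1 ≤ k → k ≤ (m : ℝ) ^ 2 → L = ⌊(m : ℝ) ^ 2 / k⌋₊ →
      ∀ (Ω : Type u) [MeasurableSpace Ω] (P : Measure Ω) [IsProbabilityMeasure P]
        (S S' : Ω → Finset ℕ) (Δ : Ω → ℕ),
        DiscreteRV S → DiscreteRV S' → DiscreteRV Δ →
        HasCatalanLaw P U m S → IsUniformOffset P L Δ → DiscreteIndep P S Δ →
        (∀ᵐ ω ∂P, S' ω ⊆ S ω) →
        ∫ ω, ((S' ω).card : ℝ) ∂P = (1 - ε) * (m : ℝ) →
        Integrable (fun ω => (unknownCount L (Δ ω) (S ω) (S' ω) : ℝ)) P ∧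
          ∫ ω, (unknownCount L (Δ ω) (S ω) (S' ω) : ℝ) ∂P
            ≤ C * (Real.sqrt (ε * k) + Real.log (m : ℝ)) := by
  have hb : 0 < b := ha.trans_le hab
  -- Chosen so that `U ≤ b * m ^ 2` gives `6 * (U + 1) ≤ κ * (m * (m + 5))`.
  set κ : ℝ := 6 * (b + 1) with hκdef
  have hκ : 1 ≤ κ := by linarith
  refine ⟨128 * κ ^ 2 + 4, by positivity, ?_⟩
  intro m U L k ε hm hmU _ hUb hk hkm hLdef Ω _ P _ S S' Δ hS hS' hΔ hlaw hunif hind hsub hcard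
  have hm1 : (1 : ℝ) ≤ m := by exact_mod_cast hm
  have hm0 : (0 : ℝ) < m := by linarith
  have hk0 : (0 : ℝ) < k := by linarith
  have hL : 0 < L := by
    rw [hLdef, Nat.floor_pos, le_div_iff₀ hk0, one_mul]
    exact hkm
  have hL1 : (1 : ℝ) ≤ L := by exact_mod_cast hL
  -- The floor loses at most a factor `2` because `L ≥ 1`.
  have hL' : (m : ℝ) ^ 2 ≤ 2 * k * L := by
    have h1 : (m : ℝ) ^ 2 / k < L + 1 := by rw [hLdef]; exact Nat.lt_floor_add_one _
    rw [div_lt_iff₀ hk0] at h1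
    nlinarith
  have hU : 6 * ((U : ℝ) + 1) ≤ κ * (m * (m + 5)) := by
    have : (U : ℝ) + 1 ≤ (b + 1) * (m * (m + 5)) := by nlinarith
    rw [hκdef]; linarith
  have hSmem := hlaw.ae_mem hmU hS
  have hScard : ∀ᵐ ω ∂P, (S ω).card = m ∧ S ω ⊆ Finset.Icc 1 U := by
    filter_upwards [hSmem] with ω hω
    obtain ⟨s, hs, hsω⟩ := Finset.mem_image.1 hω
    rw [← hsω]
    refine ⟨card_pointSet hs, fun x hx => ?_⟩
    obtain ⟨n, hn1, hnm, rfl⟩ := mem_pointSet_iff.1 hx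
    have hst := extSeq_strictMonoOn hs
    have h1 := hst (show (0 : ℕ) ∈ Set.Iic (m + 1) from Nat.zero_le _)
      (show n ∈ Set.Iic (m + 1) from by simp only [Set.mem_Iic]; omega) (by omega)
    have h2 := hst (show n ∈ Set.Iic (m + 1) from by simp only [Set.mem_Iic]; omega)
      (show m + 1 ∈ Set.Iic (m + 1) from Set.mem_Iic.2 le_rfl) (by omega)
    rw [extSeq_last hs le_rfl] at h2
    rw [Finset.mem_Icc]
    omega
  have hS'int : Integrable (fun ω => ((S' ω).card : ℝ)) P := by
    refine Integrable.of_bound (hS'.measurable_comp fun t => (t.card : ℝ)).aestronglyMeasurable m ?_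
    filter_upwards [hScard, hsub] with ω h1 h2
    rw [Real.norm_natCast]
    exact_mod_cast (Finset.card_le_card h2).trans h1.1.le
  have hmiss : ∀ᵐ ω ∂P, ((S ω \ S' ω).card : ℝ) = m - (S' ω).card := by
    filter_upwards [hScard, hsub] with ω h1 h2
    rw [Finset.card_sdiff_of_subset h2, Nat.cast_sub (Finset.card_le_card h2), h1.1]
  have hmissint : Integrable (fun ω => ((S ω \ S' ω).card : ℝ)) P :=
    ((integrable_const (m : ℝ)).sub hS'int).congr (by
      filter_upwards [hmiss] with ω hω
      rw [hω]; rfl)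
  have hmissval : ∫ ω, ((S ω \ S' ω).card : ℝ) ∂P = ε * m := by
    rw [integral_congr_ae hmiss, integral_sub (integrable_const _) hS'int, hcard]
    simp
    ring
  have hε0 : 0 ≤ ε := by
    have : 0 ≤ ε * m := by rw [← hmissval]; exact integral_nonneg fun _ => by positivity
    exact nonneg_of_mul_nonneg_left this hm0
  have hε1 : ε ≤ 1 := by
    have : 0 ≤ (1 - ε) * m := by rw [← hcard]; exact integral_nonneg fun _ => by positivity
    linarith [nonneg_of_mul_nonneg_left this hm0]
  have hint : Integrable (fun ω => (unknownCount L (Δ ω) (S ω) (S' ω) : ℝ)) P := by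
    refine hmissint.mono' ((hS.prodMk (hS'.prodMk hΔ)).measurable_comp
      fun x : Finset ℕ × Finset ℕ × ℕ =>
        (unknownCount L x.2.2 x.1 x.2.1 : ℝ)).aestronglyMeasurable ?_
    refine Filter.Eventually.of_forall fun ω => ?_
    rw [Real.norm_natCast]
    exact_mod_cast unknownCount_le_card_sdiff hL _ _
  refine ⟨hint, ?_⟩
  have hlog : 0 ≤ Real.log m := Real.log_nonneg hm1
  have hsq : 0 ≤ Real.sqrt (ε * k) := Real.sqrt_nonneg _
  have hκ2 : 0 ≤ κ ^ 2 := by positivity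
  -- In this case the threshold `Θ` below could fall under `1`, but the trivial bound `ε * m` by the
  -- number of missing points already suffices.
  by_cases hcase : ε * (m : ℝ) ^ 2 ≤ k
  · have h1 : ∫ ω, (unknownCount L (Δ ω) (S ω) (S' ω) : ℝ) ∂P ≤ ε * m := by
      rw [← hmissval]
      refine integral_mono hint hmissint fun ω => ?_
      exact Nat.cast_le.2 (unknownCount_le_card_sdiff hL _ _)
    have h2 : ε * m ≤ Real.sqrt (ε * k) := by
      apply Real.le_sqrt_of_sq_le
      calc (ε * m) ^ 2 = ε * (ε * (m : ℝ) ^ 2) := by ring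
        _ ≤ ε * k := mul_le_mul_of_nonneg_left hcase hε0
    have h3 : 0 ≤ κ ^ 2 * Real.sqrt (ε * k) := by positivity
    have h4 : 0 ≤ κ ^ 2 * Real.log m := by positivity
    nlinarith
  · push Not at hcase
    -- For `m = 1` the case assumption would read `k < ε ≤ 1`. Having `m ≥ 2` lets `4 * log m`
    -- absorb the two end intervals.
    have hm2 : (2 : ℝ) ≤ m := by
      have : m ≠ 1 := by
        rintro rfl
        norm_num at hcase
        linarith
      exact_mod_cast (by omega : 2 ≤ m)
    set ρ := Real.sqrt (ε * k) with hρ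
    have hρ2 : ρ ^ 2 = ε * k := Real.sq_sqrt (by positivity)
    have hεpos : 0 < ε := by
      rcases hε0.eq_or_lt with h | h
      · rw [← h] at hcase; linarith
      · exact h
    have hρpos : 0 < ρ := Real.sqrt_pos.2 (by positivity)
    -- This balances the two contributions: `ε * m / Θ = ρ`, while `m * Θ / L` is of order `k * Θ /
    -- m = ρ`.
    set Θ : ℝ := m * ρ / k with hΘ
    have hΘ1 : 1 ≤ Θ := by
      rw [hΘ, le_div_iff₀ hk0, one_mul]
      refine le_of_sq_le_sq ?_ (by positivity)
      rw [mul_pow, hρ2]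
      nlinarith
    set r := ⌊Θ⌋₊ with hr
    have hr1 : 1 ≤ r := by rw [hr, Nat.one_le_floor_iff]; exact hΘ1
    have hrle : (r : ℝ) ≤ Θ := Nat.floor_le (by linarith)
    have hrlt : Θ < r + 1 := Nat.lt_floor_add_one _
    obtain ⟨hfi, hfle⟩ := integral_card_fewBlocks_le hκ hm hmU hU hL hr1 hS hΔ hlaw hunif hind
    have hptw : ∀ᵐ ω ∂P, (unknownCount L (Δ ω) (S ω) (S' ω) : ℝ) ≤
        (((fewBlocks L (Δ ω) U r (S ω)).card : ℝ) + 2) + ((S ω \ S' ω).card : ℝ) * (1 / Θ) := by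
      filter_upwards [hScard, hunif.ae_mem hL hΔ] with ω h1 h2
      have h3 := mul_unknownCount_le (r := r) (t' := S' ω) h1.2 h2
      have h4 : ((r : ℝ) + 1) * (unknownCount L (Δ ω) (S ω) (S' ω) : ℝ) ≤
          (r + 1) * (((fewBlocks L (Δ ω) U r (S ω)).card : ℝ) + 2) + ((S ω \ S' ω).card : ℝ) := by
        exact_mod_cast h3
      have hrp : (0 : ℝ) < (r : ℝ) + 1 := by positivity
      have h5 : ((S ω \ S' ω).card : ℝ) ≤ (r + 1) * (((S ω \ S' ω).card : ℝ) * (1 / Θ)) := by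
        rw [mul_one_div, ← mul_div_assoc, le_div_iff₀ (by linarith), mul_comm]
        exact mul_le_mul_of_nonneg_right hrlt.le (by positivity)
      refine le_of_mul_le_mul_left ?_ hrp
      linarith
    have hfi2 : Integrable (fun ω => ((fewBlocks L (Δ ω) U r (S ω)).card : ℝ) + 2) P :=
      hfi.add (integrable_const 2)
    have hmi2 : Integrable (fun ω => ((S ω \ S' ω).card : ℝ) * (1 / Θ)) P := hmissint.mul_const _
    have h1 := integral_mono_ae hint (hfi2.add hmi2) hptw
    simp only [Pi.add_apply] at h1
    rw [integral_add hfi2 hmi2, integral_add hfi (integrable_const 2), integral_mul_const,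
      hmissval] at h1
    simp only [integral_const, probReal_univ, smul_eq_mul, one_mul] at h1
    have h2 : ε * m * (1 / Θ) = ρ := by
      rw [hΘ]
      field_simp
      linarith
    have h3 : 32 * κ ^ 2 * (m + 1) * r / L ≤ 128 * κ ^ 2 * ρ := by
      rw [div_le_iff₀ (by linarith)]
      have h4 : ((m : ℝ) + 1) * r ≤ 4 * ρ * L := by
        calc ((m : ℝ) + 1) * r ≤ (2 * m) * Θ := by gcongr; linarith
          _ = (m : ℝ) ^ 2 * (2 * ρ / k) := by rw [hΘ]; ring
          _ ≤ (2 * k * L) * (2 * ρ / k) := mul_le_mul_of_nonneg_right hL' (by positivity)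
          _ = 4 * ρ * L := by field_simp; ring
      nlinarith [mul_le_mul_of_nonneg_left h4 hκ2]
    have hlog2 : 2 ≤ 4 * Real.log m := by
      have := Real.log_le_log two_pos hm2
      linarith [Real.log_two_gt_d9]
    have h5 : 0 ≤ κ ^ 2 * Real.log m := by positivity
    nlinarith
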